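/- Let $k$ be a field (of any characteristic), let $R = k[[x_1,\dots,x_n]]$, and let $\Gamma = k_{DP}[y_1,\dots,y_n]$ be the divided power ring, that is, the $k$-vector space with basis the divided power monomials $y^\beta$, $\beta\in\mathbb N^n$, regarded as an $R$-module by contraction: $f\circ y^\beta=\sum_{\alpha\le\beta} f_\alpha\, y^{\beta-\alpha}$ for $f=\sum_\alpha f_\alpha x^\alpha\in R$, extended $k$-linearly to $\Gamma$ (so $x^\alpha\circ y^\beta = y^{\beta-\alpha}$ if $\alpha\le\beta$ componentwise, and $0$ otherwise). Let $I$ be an ideal of $R$ such that the ring $A = R/I$ has Krull dimension one, and let $I^\perp=\{F\in\Gamma : f\circ F=0 \text{ for all } f\in I\}$ be the inverse system of $I$, regarded as an $A$-module. The following conditions are equivalent: (i) $I$ is a prime ideal; (ii) $I^\perp$ is an almost finitely generated $A$-module, i.e. $I^\perp$ is not a finitely generated $A$-module, but every proper $A$-submodule of $I^\perp$ is finitely generated; (iii) $I^\perp$ is a divisible $A$-module, i.e. $a\,I^\perp=I^\perp$ for every $a\in A\setminus\{0\}$. -/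

import Mathlib

namespace InverseSystem

/-- The divided power ring `Γ = k_DP[y_1, …, y_n]`, as the `k`-vector space with basis the divided
power monomials `y^β`, `β ∈ ℕⁿ`. (Its internal product plays no role for inverse systems; what
matters is the module structure over `k⟦x_1, …, x_n⟧` given by contraction, below.) -/
def Gamma (n : ℕ) (k : Type*) [Field k] : Type _ := (Fin n →₀ ℕ) →₀ k

namespace Gamma

variable {n : ℕ} {k : Type*} [Field k]

noncomputable instance : AddCommGroup (Gamma n k) :=
  inferInstanceAs (AddCommGroup ((Fin n →₀ ℕ) →₀ k))

/-- The term `c y^β` of `Γ`. -/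
noncomputable def term (β : Fin n →₀ ℕ) (c : k) : Gamma n k := Finsupp.single β c

/-- The contraction of a single term `c y^β` by a power series `f = ∑ f_α x^α`, that is
`∑_{α + γ = β} f_α c y^γ`. -/
noncomputable def contractTerm (f : MvPowerSeries (Fin n) k) (β : Fin n →₀ ℕ) : k →+ Gamma n k where
  toFun c := ∑ p ∈ Finset.HasAntidiagonal.antidiagonal β, term p.2 (MvPowerSeries.coeff p.1 f * c)
  map_zero' := Finset.sum_eq_zero fun p _ => by
    rw [mul_zero]; exact Finsupp.single_zero _
  map_add' c d := by
    rw [← Finset.sum_add_distrib]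
    refine Finset.sum_congr rfl fun p _ => ?_
    rw [mul_add]; exact Finsupp.single_add _ _ _

/-- The contraction `f ∘ g` for `f ∈ k⟦x_1, …, x_n⟧` and `g ∈ Γ`: the additive extension in `g` of
the contraction of terms. -/
noncomputable def contract (f : MvPowerSeries (Fin n) k) : Gamma n k →+ Gamma n k :=
  Finsupp.liftAddHom (contractTerm f)

theorem contract_term (f : MvPowerSeries (Fin n) k) (β : Fin n →₀ ℕ) (c : k) :
    contract f (term β c) =
      ∑ p ∈ Finset.HasAntidiagonal.antidiagonal β, term p.2 (MvPowerSeries.coeff p.1 f * c) :=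
  Finsupp.liftAddHom_apply_single _ _ _

theorem induction_on {P : Gamma n k → Prop} (g : Gamma n k) (h0 : P 0)
    (hadd : ∀ g h, P g → P h → P (g + h)) (hterm : ∀ β c, P (term β c)) : P g :=
  Finsupp.induction_linear g h0 hadd hterm

theorem term_add (β : Fin n →₀ ℕ) (c d : k) : term β (c + d) = term β c + term β d :=
  Finsupp.single_add _ _ _

theorem term_zero (β : Fin n →₀ ℕ) : term β (0 : k) = 0 :=
  Finsupp.single_zero _

/-- `x^α ∘ y^β` is `y^(β - α)` if `α ≤ β` componentwise, and `0` otherwise. -/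
theorem contract_monomial (α β : Fin n →₀ ℕ) :
    contract (MvPowerSeries.monomial α (1 : k)) (term β 1) =
      if α ≤ β then term (β - α) 1 else 0 := by
  classical
  rw [contract_term]
  simp only [MvPowerSeries.coeff_monomial, mul_one]
  split_ifs with h
  · rw [Finset.sum_eq_single (α, β - α)]
    · simp
    · rintro ⟨a, b⟩ hp hne
      rw [if_neg, term_zero]
      rintro rfl
      rw [Finset.HasAntidiagonal.mem_antidiagonal] at hp
      apply hne
      simp only [Prod.mk.injEq, true_and]
      rw [← hp]; simp
    · intro hp
      exact absurd (Finset.HasAntidiagonal.mem_antidiagonal.2 (add_tsub_cancel_of_le h)) hp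
  · refine Finset.sum_eq_zero fun p hp => ?_
    rw [if_neg, term_zero]
    rintro rfl
    rw [Finset.HasAntidiagonal.mem_antidiagonal] at hp
    exact h (hp ▸ le_self_add)

theorem one_contract (g : Gamma n k) : contract (1 : MvPowerSeries (Fin n) k) g = g := by
  induction g using induction_on with
  | h0 => exact map_zero _
  | hadd g h hg hh => rw [map_add, hg, hh]
  | hterm β c =>
    classical
    rw [contract_term, Finset.sum_eq_single (0, β)]
    · simp
    · rintro ⟨a, b⟩ hp hne
      rw [MvPowerSeries.coeff_one, if_neg, zero_mul, term_zero]
      rintro rfl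
      simp at hp
      exact hne (by rw [hp])
    · intro hp
      simp at hp

theorem mul_contract (f g : MvPowerSeries (Fin n) k) (h : Gamma n k) :
    contract (f * g) h = contract f (contract g h) := by
  induction h using induction_on with
  | h0 => simp only [map_zero]
  | hadd u v hu hv => simp only [map_add, hu, hv]
  | hterm β c =>
    classical
    rw [mul_comm f g]
    simp only [contract_term, map_sum, MvPowerSeries.coeff_mul, Finset.sum_mul]
    have hsum : ∀ (s : Finset ((Fin n →₀ ℕ) × (Fin n →₀ ℕ)))
        (u : (Fin n →₀ ℕ) × (Fin n →₀ ℕ) → k) (γ : Fin n →₀ ℕ),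
        term γ (∑ q ∈ s, u q) = ∑ q ∈ s, term γ (u q) := fun s u γ =>
      map_sum (Finsupp.singleAddHom γ) u s
    simp only [hsum, Finset.sum_sigma']
    refine Finset.sum_nbij' (fun ⟨⟨_, c⟩, ⟨a, b⟩⟩ => ⟨(a, b + c), (b, c)⟩)
      (fun ⟨⟨a, _⟩, ⟨b, c⟩⟩ => ⟨(a + b, c), (a, b)⟩) ?_ ?_ ?_ ?_ ?_
    · rintro ⟨⟨_, c⟩, ⟨a, b⟩⟩ h
      simp only [Finset.mem_sigma, Finset.HasAntidiagonal.mem_antidiagonal] at h ⊢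
      exact ⟨by rw [← h.1, ← h.2, add_assoc], trivial⟩
    · rintro ⟨⟨a, _⟩, ⟨b, c⟩⟩ h
      simp only [Finset.mem_sigma, Finset.HasAntidiagonal.mem_antidiagonal] at h ⊢
      exact ⟨by rw [← h.1, ← h.2, add_assoc], trivial⟩
    · rintro ⟨⟨_, c⟩, ⟨a, b⟩⟩ h
      simp only [Finset.mem_sigma, Finset.HasAntidiagonal.mem_antidiagonal] at h
      obtain ⟨_, rfl⟩ := h
      rfl
    · rintro ⟨⟨a, _⟩, ⟨b, c⟩⟩ h
      simp only [Finset.mem_sigma, Finset.HasAntidiagonal.mem_antidiagonal] at h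
      obtain ⟨_, rfl⟩ := h
      rfl
    · rintro ⟨⟨_, c⟩, ⟨a, b⟩⟩ _
      congr 1
      ring

/-- `R = k⟦x_1, …, x_n⟧` acts on `Γ` by contraction: `f • F = f ∘ F`. -/
noncomputable instance : Module (MvPowerSeries (Fin n) k) (Gamma n k) where
  smul f g := contract f g
  one_smul := one_contract
  mul_smul := mul_contract
  smul_zero f := map_zero (contract f)
  smul_add f := map_add (contract f)
  add_smul f g h := by
    change contract (f + g) h = contract f h + contract g h
    induction h using induction_on with
    | h0 => simp only [map_zero, add_zero]
    | hadd u v hu hv => rw [map_add, hu, hv, map_add, map_add]; abel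
    | hterm β c =>
      simp only [contract_term, map_add, add_mul, term_add, Finset.sum_add_distrib]
  zero_smul h := by
    change contract 0 h = 0
    induction h using induction_on with
    | h0 => exact map_zero _
    | hadd u v hu hv => rw [map_add, hu, hv, add_zero]
    | hterm β c =>
      simp only [contract_term, map_zero, zero_mul, term_zero, Finset.sum_const_zero]

end Gamma

/-- Macaulay's inverse system `I^⊥ = {F ∈ Γ | I ∘ F = 0}`. It is a `k⟦x_1, …, x_n⟧`-submodule of
`Γ`, and a module over `k⟦x_1, …, x_n⟧ ⧸ I` through Mathlib's instance on `torsionBySet`. -/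
noncomputable abbrev perp {n : ℕ} {k : Type*} [Field k] (I : Ideal (MvPowerSeries (Fin n) k)) :
    Submodule (MvPowerSeries (Fin n) k) (Gamma n k) :=
  Submodule.torsionBySet (MvPowerSeries (Fin n) k) (Gamma n k) I

/-- `M` is almost finitely generated: it is not finitely generated, but every proper submodule
is. -/
def IsAlmostFinitelyGenerated (A M : Type*) [CommRing A] [AddCommGroup M] [Module A M] : Prop :=
  ¬ Module.Finite A M ∧ ∀ N : Submodule A M, N ≠ ⊤ → N.FG

/-- `M` is divisible: `a M = M` for every nonzero `a ∈ A`. -/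
def IsDivisibleModule (A M : Type*) [CommRing A] [AddCommGroup M] [Module A M] : Prop :=
  ∀ a : A, a ≠ 0 → ∀ m : M, ∃ m' : M, a • m' = m

end InverseSystem

/-! The theorem is Macaulay–Matlis duality. The pairing `(f, F) ↦ coeff 0 (f • F)` makes `R` the
`k`-linear dual of `Γ`, whence two double annihilator statements: a submodule of `Γ` is determined
by its annihilator (`exists_smul_eq_zero_of_notMem`), and `I` is the full annihilator of `I^⊥`
(`mem_of_forall_perp_smul_eq_zero`). (i) ⇒ (ii): a proper submodule of `I^⊥` has annihilator larger
than `I`. Since `A` is a one-dimensional local domain, that annihilator contains a power of each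
variable, which bounds exponents. If `I^⊥` itself were finitely generated, powers of the variables
would lie in `I`, making `I` maximal. (ii) ⇒ (iii): for `a ≠ 0`, multiplication by `a` has proper
kernel, as `I^⊥` is faithful over `A`. Were its image proper too, `I^⊥` would be an extension of
finitely generated modules. (iii) ⇒ (i): surjectivity of `a` on `I^⊥` makes `a` a nonzerodivisor on
`A`. -/

namespace InverseSystem

open MvPowerSeries

section

variable {n : ℕ} {k : Type*} [Field k]

/-! ### The pairing of `Γ` with power series -/

namespace Gamma

/-- The coefficient of `y^β`. -/
noncomputable def coeff (β : Fin n →₀ ℕ) : Gamma n k →+ k :=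
  Finsupp.applyAddHom β

theorem ext {F G : Gamma n k} (h : ∀ β, coeff β F = coeff β G) : F = G :=
  Finsupp.ext h

theorem coeff_term [DecidableEq (Fin n →₀ ℕ)] (γ β : Fin n →₀ ℕ) (c : k) :
    coeff γ (term β c) = if β = γ then c else 0 :=
  Finsupp.single_apply

theorem sum_term_coeff (F : Gamma n k) :
    ∃ s : Finset (Fin n →₀ ℕ), (∀ β ∈ s, coeff β F ≠ 0) ∧
      ∑ β ∈ s, term β (coeff β F) = F :=
  ⟨Finsupp.support F, fun _ => Finsupp.mem_support_iff.1, Finsupp.sum_single F⟩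

theorem smul_term (f : MvPowerSeries (Fin n) k) (β : Fin n →₀ ℕ) (c : k) :
    f • term β c = ∑ p ∈ Finset.HasAntidiagonal.antidiagonal β,
      term p.2 (MvPowerSeries.coeff p.1 f * c) :=
  contract_term f β c

theorem coeff_zero_smul_term (f : MvPowerSeries (Fin n) k) (β : Fin n →₀ ℕ) (c : k) :
    coeff 0 (f • term β c) = MvPowerSeries.coeff β f * c := by
  classical
  simp only [smul_term, map_sum, coeff_term]
  rw [Finset.sum_eq_single (β, 0)]
  · simp
  · rintro ⟨a, b⟩ hp hne
    refine if_neg ?_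
    rintro rfl
    simp at hp
    exact hne (by rw [hp])
  · intro hp
    simp at hp

/-- Reduces every coefficient to the pairing, so vanishing in `Γ` can be tested with `coeff 0`
alone. -/
theorem coeff_eq_coeff_zero_smul (γ : Fin n →₀ ℕ) (F : Gamma n k) :
    coeff γ F = coeff 0 (monomial γ (1 : k) • F) := by
  classical
  induction F using induction_on with
  | h0 => simp
  | hadd F G hF hG => rw [smul_add, map_add, map_add, hF, hG]
  | hterm β c => simp [coeff_zero_smul_term, coeff_term, MvPowerSeries.coeff_monomial]

theorem C_smul_term (a : k) (β : Fin n →₀ ℕ) (c : k) :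
    (C a : MvPowerSeries (Fin n) k) • term β c = term β (a * c) := by
  classical
  refine ext fun γ => ?_
  rw [coeff_eq_coeff_zero_smul, smul_smul, coeff_zero_smul_term, coeff_term, coeff_mul_C,
    MvPowerSeries.coeff_monomial]
  split_ifs <;> simp

/-- Every `k`-linear functional on `Γ` is the pairing with a power series, so a submodule of `Γ` is
determined by its annihilator. -/
theorem exists_smul_eq_zero_of_notMem (N : Submodule (MvPowerSeries (Fin n) k) (Gamma n k))
    {F : Gamma n k} (hF : F ∉ N) :
    ∃ f : MvPowerSeries (Fin n) k, (∀ G ∈ N, f • G = 0) ∧ f • F ≠ 0 := by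
  let _ : Module k (Gamma n k) := Finsupp.module (Fin n →₀ ℕ) k
  have hC (a : k) (G : Gamma n k) : a • G = (C a : MvPowerSeries (Fin n) k) • G := by
    induction G using induction_on with
    | h0 => simp
    | hadd G H hG hH => rw [smul_add, smul_add, hG, hH]
    | hterm β c =>
      rw [C_smul_term]
      exact Finsupp.smul_single a β c
  let N' : Submodule k (Gamma n k) :=
    { N.toAddSubmonoid with
      smul_mem' := fun a G hG => by
        rw [hC]
        exact N.smul_mem _ hG }
  obtain ⟨φ, hφF, hφN⟩ := Submodule.exists_le_ker_of_notMem (p := N') (v := F) hF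
  let f : MvPowerSeries (Fin n) k := fun β => φ (term β 1)
  have hf (G : Gamma n k) : coeff 0 (f • G) = φ G := by
    induction G using induction_on with
    | h0 => simp
    | hadd G H hG hH => rw [smul_add, map_add, map_add, hG, hH]
    | hterm β c =>
      rw [coeff_zero_smul_term, ← mul_one c, ← C_smul_term, ← hC, map_smul, smul_eq_mul, mul_one,
        mul_comm]
      rfl
  refine ⟨f, fun G hG => ext fun γ => ?_, fun h => hφF ?_⟩
  -- The `γ`-coefficient of `f • G` is `φ` of `x^γ • G`, which stays in `N`, where `φ` vanishes.
  · rw [coeff_eq_coeff_zero_smul, smul_comm, hf, map_zero]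
    exact hφN (N.smul_mem _ hG)
  · rw [← hf, h, map_zero]

theorem exists_X_pow_smul_eq_zero (F : Gamma n k) :
    ∃ M : ℕ, ∀ i, (X i : MvPowerSeries (Fin n) k) ^ M • F = 0 := by
  classical
  induction F using induction_on with
  | h0 => exact ⟨0, by simp⟩
  | hadd F G hF hG =>
    obtain ⟨M, hM⟩ := hF
    obtain ⟨N, hN⟩ := hG
    refine ⟨M + N, fun i => ?_⟩
    rw [smul_add, pow_add, mul_smul, mul_smul, hN, smul_zero, smul_comm, hM, smul_zero, add_zero]
  | hterm β c =>
    refine ⟨β.degree + 1, fun i => ext fun γ => ?_⟩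
    rw [coeff_eq_coeff_zero_smul, smul_smul, coeff_zero_smul_term, map_zero, X_pow_eq,
      monomial_mul_monomial, MvPowerSeries.coeff_monomial, if_neg, zero_mul]
    intro h
    have h1 := Finsupp.le_degree i β
    have h2 := DFunLike.congr_fun h i
    rw [Finsupp.add_apply, Finsupp.single_eq_same] at h2
    omega

/-- The exponents `β` with `β i < M` for all `i`, a finite set. -/
theorem finite_setOf_forall_lt (n M : ℕ) : {β : Fin n →₀ ℕ | ∀ i, β i < M}.Finite := by
  refine (Set.finite_Iic (Finsupp.equivFunOnFinite.symm fun _ : Fin n => M)).subset ?_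
  intro β hβ i
  simpa using (hβ i).le

/-- Such an `N` lies in the span of the finitely many `y^β` with all `β i < M`, a Noetherian module.
-/
theorem fg_of_X_pow_smul_eq_zero (N : Submodule (MvPowerSeries (Fin n) k) (Gamma n k)) (M : ℕ)
    (hN : ∀ F ∈ N, ∀ i, (X i : MvPowerSeries (Fin n) k) ^ M • F = 0) : N.FG := by
  have := isNoetherian_span_of_finite (MvPowerSeries (Fin n) k)
    ((finite_setOf_forall_lt n M).image fun β => (term β 1 : Gamma n k))
  refine isNoetherian_submodule.1 this N fun F hF => ?_
  obtain ⟨s, hs, hsum⟩ := sum_term_coeff F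
  rw [← hsum]
  refine Submodule.sum_mem _ fun β hβ => ?_
  rw [← mul_one (coeff β F), ← C_smul_term]
  refine Submodule.smul_mem _ _ (Submodule.subset_span ⟨β, fun i => ?_, rfl⟩)
  by_contra! hi
  refine hs β hβ ?_
  rw [coeff_eq_coeff_zero_smul, show β = (β - Finsupp.single i M) + Finsupp.single i M from ?_,
    ← mul_one (1 : k), ← monomial_mul_monomial, ← X_pow_eq, mul_smul, hN F hF, smul_zero, map_zero]
  exact (tsub_add_cancel_of_le (by simpa using hi)).symm

end Gamma

/-! ### The annihilator of the inverse system -/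

/-- A power series whose monomials are all divisible by some `x_i^M` lies in every ideal that
contains all the `x_i^M`. -/
theorem mem_of_X_pow_mem {J : Ideal (MvPowerSeries (Fin n) k)} {M : ℕ}
    (hJ : ∀ i, (X i : MvPowerSeries (Fin n) k) ^ M ∈ J) {f : MvPowerSeries (Fin n) k}
    (hf : ∀ β : Fin n →₀ ℕ, (∀ i, β i < M) → MvPowerSeries.coeff β f = 0) : f ∈ J := by
  classical
  suffices ∀ (s : Finset (Fin n)) (f : MvPowerSeries (Fin n) k),
      (∀ β : Fin n →₀ ℕ, (∀ i ∈ s, β i < M) → MvPowerSeries.coeff β f = 0) → f ∈ J from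
    this Finset.univ f fun β hβ => hf β fun i => hβ i (Finset.mem_univ i)
  intro s
  induction s using Finset.induction_on with
  | empty =>
    intro f hf
    rw [show f = 0 from MvPowerSeries.ext fun β => hf β (by simp)]
    exact J.zero_mem
  | insert i s _ ih =>
    intro f hf
    -- `g` collects the terms of `f` divisible by `x_i^M`; the rest, `f - g`, meets the hypothesis
    -- for `s`.
    let g : MvPowerSeries (Fin n) k := fun β => if β i < M then 0 else MvPowerSeries.coeff β f
    have hg (β : Fin n →₀ ℕ) :
      MvPowerSeries.coeff β g = if β i < M then 0 else MvPowerSeries.coeff β f := rfl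
    rw [← sub_add_cancel f g]
    refine J.add_mem (ih _ fun β hβ => ?_) (J.mem_of_dvd ?_ (hJ i))
    · rw [map_sub, hg]
      split_ifs with h
      · rw [hf β (by simpa using ⟨h, hβ⟩), sub_zero]
      · exact sub_self _
    · rw [X_pow_dvd_iff]
      intro β hβ
      rw [hg, if_pos hβ]

/-- Only functionals on `R` that vanish on some `m ^ M` come from elements of `Γ`. Krull's
intersection theorem keeps `f` nonzero in `A / m ^ M A`, and a functional there that is nonzero on
`f` pulls back to one of this kind. -/
theorem exists_mem_perp_smul_ne_zero {I : Ideal (MvPowerSeries (Fin n) k)}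
    {f : MvPowerSeries (Fin n) k} (hf : f ∉ I) : ∃ F ∈ perp I, f • F ≠ 0 := by
  classical
  let R := MvPowerSeries (Fin n) k
  let m := IsLocalRing.maximalIdeal R
  have hX (i : Fin n) : (X i : R) ∈ m := by
    rw [IsLocalRing.mem_maximalIdeal, mem_nonunits_iff, isUnit_iff_constantCoeff]
    simp
  obtain ⟨M, hM⟩ : ∃ M : ℕ, Ideal.Quotient.mk I f ∉ m ^ M • (⊤ : Submodule R (R ⧸ I)) := by
    by_contra! h
    have := Ideal.iInf_pow_smul_eq_bot_of_isLocalRing (M := R ⧸ I) m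
      (IsLocalRing.maximalIdeal.isMaximal R).ne_top
    have hmem : Ideal.Quotient.mk I f ∈ ⨅ i, m ^ i • (⊤ : Submodule R (R ⧸ I)) :=
      (Submodule.mem_iInf _).2 h
    rw [this, Submodule.mem_bot, Ideal.Quotient.eq_zero_iff_mem] at hmem
    exact hf hmem
  obtain ⟨φ, hφf, hφ⟩ := Submodule.exists_le_ker_of_notMem (K := k)
    (p := (m ^ M • (⊤ : Submodule R (R ⧸ I))).restrictScalars k) hM
  let ψ : R →ₗ[k] k := φ ∘ₗ (Ideal.Quotient.mkₐ k I).toLinearMap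
  have hψI (g : R) (hg : g ∈ I) : ψ g = 0 := by
    have : Ideal.Quotient.mk I g = 0 := Ideal.Quotient.eq_zero_iff_mem.2 hg
    simp [ψ, this]
  have hψm (g : R) (hg : g ∈ m ^ M) : ψ g = 0 := by
    refine hφ (?_ : Ideal.Quotient.mk I g ∈ m ^ M • (⊤ : Submodule R (R ⧸ I)))
    rw [← mul_one g, map_mul, ← Ideal.Quotient.algebraMap_eq, ← Algebra.smul_def]
    exact Submodule.smul_mem_smul hg Submodule.mem_top
  let s := (Gamma.finite_setOf_forall_lt n M).toFinset
  let F : Gamma n k := ∑ β ∈ s, Gamma.term β (ψ (monomial β 1))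
  have hF (g : R) : Gamma.coeff 0 (g • F) = ψ g := by
    -- With the exponents in `s` removed, each remaining monomial is divisible by some `x_i^M`.
    have h1 : ψ (g - ∑ β ∈ s, MvPowerSeries.coeff β g • monomial β (1 : k)) = 0 := by
      refine hψm _ (mem_of_X_pow_mem (fun i => Ideal.pow_mem_pow (hX i) M) fun β hβ => ?_)
      have hβs : β ∈ s := by simpa [s] using hβ
      simp [MvPowerSeries.coeff_monomial, hβs]
    rw [map_sub, sub_eq_zero, map_sum] at h1
    rw [h1, Finset.smul_sum, map_sum]
    exact Finset.sum_congr rfl fun β _ => by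
      rw [Gamma.coeff_zero_smul_term, map_smul, smul_eq_mul]
  refine ⟨F, (Submodule.mem_torsionBySet_iff _ _).2 ?_, fun h => hφf ?_⟩
  · rintro ⟨g, hg⟩
    refine Gamma.ext fun γ => ?_
    rw [Gamma.coeff_eq_coeff_zero_smul, smul_smul, hF, map_zero]
    exact hψI _ (I.mul_mem_left _ hg)
  · exact (hF f).symm.trans (by rw [h, map_zero])

variable {I : Ideal (MvPowerSeries (Fin n) k)}

theorem smul_eq_zero_of_mem_perp {f : MvPowerSeries (Fin n) k} (hf : f ∈ I) {F : Gamma n k}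
    (hF : F ∈ perp I) : f • F = 0 :=
  (Submodule.mem_torsionBySet_iff _ _).1 hF ⟨f, hf⟩

/-- Only the elements of `I` annihilate the whole of `I^⊥`. -/
theorem mem_of_forall_perp_smul_eq_zero {f : MvPowerSeries (Fin n) k}
    (hf : ∀ F ∈ perp I, f • F = 0) : f ∈ I := by
  by_contra h
  obtain ⟨F, hF, hne⟩ := exists_mem_perp_smul_ne_zero h
  exact hne (hf F hF)

/-- A finitely generated module of divided power polynomials is killed by a common power of the
variables. -/
theorem exists_X_pow_smul_eq_zero_of_fg {N : Submodule (MvPowerSeries (Fin n) k) (Gamma n k)}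
    (hN : N.FG) : ∃ M : ℕ, ∀ F ∈ N, ∀ i, (X i : MvPowerSeries (Fin n) k) ^ M • F = 0 := by
  induction N, hN using Submodule.fg_induction with
  | singleton G =>
    obtain ⟨M, hM⟩ := Gamma.exists_X_pow_smul_eq_zero G
    refine ⟨M, fun F hF i => ?_⟩
    obtain ⟨f, rfl⟩ := Submodule.mem_span_singleton.1 hF
    rw [smul_comm, hM, smul_zero]
  | sup N₁ N₂ _ _ h₁ h₂ =>
    obtain ⟨M₁, hM₁⟩ := h₁
    obtain ⟨M₂, hM₂⟩ := h₂
    refine ⟨M₁ + M₂, fun F hF i => ?_⟩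
    obtain ⟨F₁, hF₁, F₂, hF₂, rfl⟩ := Submodule.mem_sup.1 hF
    rw [smul_add, pow_add, mul_smul, mul_smul, hM₂ F₂ hF₂, smul_zero, smul_comm, hM₁ F₁ hF₁,
      smul_zero, add_zero]

/-! ### The implications -/

theorem isDivisibleModule_perp_of_isPrime (hI : I.IsPrime) :
    IsDivisibleModule (MvPowerSeries (Fin n) k ⧸ I) (perp I) := by
  intro a ha F
  obtain ⟨r, rfl⟩ := Ideal.Quotient.mk_surjective a
  by_contra! h
  have hF : (F : Gamma n k) ∉ (perp I).map (LinearMap.lsmul _ (Gamma n k) r) := by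
    rintro ⟨G, hG, hGF⟩
    exact h ⟨G, hG⟩ (Subtype.ext hGF)
  obtain ⟨f, hf, hfF⟩ := Gamma.exists_smul_eq_zero_of_notMem _ hF
  have hfr : f * r ∈ I := mem_of_forall_perp_smul_eq_zero fun G hG => by
    rw [mul_smul]
    exact hf _ ⟨G, hG, rfl⟩
  rcases hI.mem_or_mem hfr with h | h
  · exact hfF (smul_eq_zero_of_mem_perp h F.2)
  · exact ha (Ideal.Quotient.eq_zero_iff_mem.2 h)

theorem isPrime_of_isDivisibleModule_perp (hI : I ≠ ⊤)
    (h : IsDivisibleModule (MvPowerSeries (Fin n) k ⧸ I) (perp I)) : I.IsPrime := by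
  refine ⟨hI, fun {x y} hxy => or_iff_not_imp_left.2 fun hx => ?_⟩
  refine mem_of_forall_perp_smul_eq_zero fun F hF => ?_
  obtain ⟨G, hG⟩ := h (Ideal.Quotient.mk I x) (fun h => hx (Ideal.Quotient.eq_zero_iff_mem.1 h))
    ⟨F, hF⟩
  have hGF : x • (G : Gamma n k) = F := congrArg Subtype.val hG
  rw [← hGF, smul_smul, mul_comm]
  exact smul_eq_zero_of_mem_perp hxy G.2

theorem IsAlmostFinitelyGenerated.isDivisibleModule_perp
    (h : IsAlmostFinitelyGenerated (MvPowerSeries (Fin n) k ⧸ I) (perp I)) :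
    IsDivisibleModule (MvPowerSeries (Fin n) k ⧸ I) (perp I) := by
  intro a ha
  obtain ⟨r, rfl⟩ := Ideal.Quotient.mk_surjective a
  let φ := LinearMap.lsmul (MvPowerSeries (Fin n) k ⧸ I) (perp I) (Ideal.Quotient.mk I r)
  suffices φ.range = ⊤ from LinearMap.range_eq_top.1 this
  by_contra hrange
  have hker : φ.ker ≠ ⊤ := fun hker => by
    refine ha (Ideal.Quotient.eq_zero_iff_mem.2 (mem_of_forall_perp_smul_eq_zero fun F hF => ?_))
    have : (⟨F, hF⟩ : perp I) ∈ φ.ker := hker ▸ Submodule.mem_top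
    exact congrArg Subtype.val (LinearMap.mem_ker.1 this)
  refine h.1 ⟨Submodule.fg_of_fg_map_of_fg_inf_ker φ ?_ ?_⟩
  · rw [Submodule.map_top]
    exact h.2 _ hrange
  · rw [top_inf_eq]
    exact h.2 _ hker

theorem isMaximal_of_X_mem (hI : I ≠ ⊤) (hX : ∀ i, (X i : MvPowerSeries (Fin n) k) ∈ I) :
    I.IsMaximal := by
  have : I = IsLocalRing.maximalIdeal (MvPowerSeries (Fin n) k) := by
    refine le_antisymm (IsLocalRing.le_maximalIdeal hI) fun f hf => ?_
    refine mem_of_X_pow_mem (M := 1) (by simpa using hX) fun β hβ => ?_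
    obtain rfl : β = 0 := Finsupp.ext fun i => by simpa using hβ i
    rw [IsLocalRing.mem_maximalIdeal, mem_nonunits_iff, isUnit_iff_constantCoeff,
      isUnit_iff_ne_zero, not_not] at hf
    exact hf
  rw [this]
  exact IsLocalRing.maximalIdeal.isMaximal _

/-- In a one-dimensional quotient domain of the power series ring, every nonzero ideal contains a
power of every variable. -/
theorem exists_X_pow_mem (hI : I.IsPrime) (hdim : ringKrullDim (MvPowerSeries (Fin n) k ⧸ I) = 1)
    {J : Ideal (MvPowerSeries (Fin n) k)} (hIJ : I < J) :
    ∃ M : ℕ, ∀ i, (X i : MvPowerSeries (Fin n) k) ^ M ∈ J := by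
  have hrad (i : Fin n) : (X i : MvPowerSeries (Fin n) k) ∈ J.radical := by
    rw [Ideal.radical_eq_sInf]
    refine Submodule.mem_sInf.2 ?_
    -- A prime above `J` has nonzero prime image in the one-dimensional domain `R ⧸ I`, so it is the
    -- maximal ideal.
    rintro (P : Ideal (MvPowerSeries (Fin n) k)) ⟨hJP, hP⟩
    have : Ring.KrullDimLE 1 (MvPowerSeries (Fin n) k ⧸ I) := Ring.krullDimLE_iff.2 hdim.le
    have hIP : I ≤ P := hIJ.le.trans hJP
    have hprime : (P.map (Ideal.Quotient.mk I)).IsPrime :=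
      Ideal.map_isPrime_of_surjective Ideal.Quotient.mk_surjective (by rwa [Ideal.mk_ker])
    have hne : P.map (Ideal.Quotient.mk I) ≠ ⊥ := fun h => by
      rw [Ideal.map_eq_bot_iff_le_ker, Ideal.mk_ker] at h
      exact (hIJ.trans_le hJP).not_ge h
    have hmax := hprime.isMaximal_of_ne_bot hne
    have hPmax : P.IsMaximal := by
      have := Ideal.comap_isMaximal_of_surjective (Ideal.Quotient.mk I)
        Ideal.Quotient.mk_surjective (K := P.map (Ideal.Quotient.mk I))
      rwa [Ideal.comap_map_of_surjective _ Ideal.Quotient.mk_surjective, ← RingHom.ker_eq_comap_bot,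
        Ideal.mk_ker, sup_eq_left.2 hIP] at this
    rw [IsLocalRing.eq_maximalIdeal hPmax, IsLocalRing.mem_maximalIdeal, mem_nonunits_iff,
      isUnit_iff_constantCoeff]
    simp
  choose M hM using hrad
  exact ⟨∑ i, M i, fun i => J.mem_of_dvd (pow_dvd_pow _
    (Finset.single_le_sum (fun _ _ => Nat.zero_le _) (Finset.mem_univ i))) (hM i)⟩

theorem fg_of_map_subtype_fg (N : Submodule (MvPowerSeries (Fin n) k ⧸ I) (perp I))
    (hN : ((N.restrictScalars (MvPowerSeries (Fin n) k)).map (perp I).subtype).FG) : N.FG :=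
  .of_restrictScalars (MvPowerSeries (Fin n) k)
    (Submodule.fg_of_fg_map_injective _ (perp I).injective_subtype hN)

theorem isAlmostFinitelyGenerated_perp_of_isPrime (hI : I.IsPrime)
    (hdim : ringKrullDim (MvPowerSeries (Fin n) k ⧸ I) = 1) :
    IsAlmostFinitelyGenerated (MvPowerSeries (Fin n) k ⧸ I) (perp I) := by
  refine ⟨fun h => ?_, fun N hN => fg_of_map_subtype_fg N ?_⟩
  · have hfin : Module.Finite (MvPowerSeries (Fin n) k) (perp I) :=
      Module.Finite.trans (MvPowerSeries (Fin n) k ⧸ I) (perp I)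
    obtain ⟨M, hM⟩ := exists_X_pow_smul_eq_zero_of_fg (Module.Finite.iff_fg.1 hfin)
    have := isMaximal_of_X_mem hI.ne_top fun i =>
      hI.mem_of_pow_mem M (mem_of_forall_perp_smul_eq_zero fun F hF => hM F hF i)
    have h0 := ringKrullDim_eq_zero_of_isField
      ((Ideal.Quotient.maximal_ideal_iff_isField_quotient I).1 this)
    rw [hdim] at h0
    exact one_ne_zero h0
  · set N' := (N.restrictScalars (MvPowerSeries (Fin n) k)).map (perp I).subtype
    obtain ⟨F, hF⟩ : ∃ F, F ∉ N := by
      by_contra! h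
      exact hN (eq_top_iff.2 fun F _ => h F)
    have hF' : (F : Gamma n k) ∉ N' := by
      rintro ⟨G, hG, hGF⟩
      exact hF (Subtype.ext hGF ▸ hG)
    obtain ⟨f, hfN, hfF⟩ := Gamma.exists_smul_eq_zero_of_notMem N' hF'
    -- Strict because `f` kills `N'` but not `F`, whereas `I` kills `F`.
    have hIJ : I < N'.annihilator := by
      refine SetLike.lt_iff_le_and_exists.2 ⟨fun g hg => Submodule.mem_annihilator.2 ?_, f,
        Submodule.mem_annihilator.2 hfN, fun hf => hfF (smul_eq_zero_of_mem_perp hf F.2)⟩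
      rintro _ ⟨G, _, rfl⟩
      exact smul_eq_zero_of_mem_perp hg G.2
    obtain ⟨M, hM⟩ := exists_X_pow_mem hI hdim hIJ
    exact Gamma.fg_of_X_pow_smul_eq_zero N' M fun G hG i => Submodule.mem_annihilator.1 (hM i) G hG

end

end InverseSystem

theorem theorem3p3 {k : Type*} [Field k] (n : ℕ) (I : Ideal (MvPowerSeries (Fin n) k))
    (hdim : ringKrullDim (MvPowerSeries (Fin n) k ⧸ I) = 1) :
    List.TFAE [
      I.IsPrime,
      InverseSystem.IsAlmostFinitelyGenerated (MvPowerSeries (Fin n) k ⧸ I) (InverseSystem.perp I),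
      InverseSystem.IsDivisibleModule (MvPowerSeries (Fin n) k ⧸ I) (InverseSystem.perp I)] := by
  -- Divisibility is vacuous over the zero ring, so (iii) ⇒ (i) needs `I` proper; the zero ring has
  -- dimension `⊥`.
  have hI : I ≠ ⊤ := by
    rintro rfl
    have : Subsingleton (MvPowerSeries (Fin n) k ⧸ (⊤ : Ideal (MvPowerSeries (Fin n) k))) :=
      Ideal.Quotient.subsingleton_iff.2 rfl
    rw [ringKrullDim_eq_bot_of_subsingleton] at hdim
    exact absurd hdim (by decide)
  tfae_have 1 → 2 := fun h => InverseSystem.isAlmostFinitelyGenerated_perp_of_isPrime h hdim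
  tfae_have 2 → 3 := fun h => h.isDivisibleModule_perp
  tfae_have 3 → 1 := fun h => InverseSystem.isPrime_of_isDivisibleModule_perp hI h
  tfae_finish
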